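/- Let $N \ge 1$ and $m \ge 0$ be integers, let $\mathbb{R}_+ = (0,\infty)$, and let $\vartheta = r\,\frac{d}{dr}$ be the Euler operator. All function spaces consist of complex-valued functions. Let $$\mathfrak{g}_0^{\mathrm{rad}} = \operatorname{span}_{\mathbb{R}}\{\,2\vartheta + N - 2,\ \ i,\ \ i(\vartheta - m)(\vartheta + m + N - 2)\,\},$$ a real vector space of differential operators on $\mathbb{R}_+$. Let $$U_N : L^2(\mathbb{R}_+, r^{N-3}\,dr) \to L^2(\mathbb{R}, ds), \qquad U_N f(s) = e^{\frac{N-2}{2}s} f(e^s),$$ and let $\mathcal{F} : L^2(\mathbb{R}, ds) \to L^2(\mathbb{R}, d\sigma)$ be the unitary Fourier transform normalized by $\mathcal{F}g(\sigma) = \frac{1}{\sqrt{2\pi}} \int_{\mathbb{R}} g(s) e^{-i\sigma s}\,ds$; both operators are unitary. A densely defined operator $T$ on a Hilbert space is called skew-adjoint if $T^* = -T$, including the domain, and a densely defined closable operator is called essentially skew-adjoint if its closure is skew-adjoint. Then every $D \in \mathfrak{g}_0^{\mathrm{rad}}$, with domain $C_{\mathrm{c}}^\infty(\mathbb{R}_+)$,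 is an essentially skew-adjoint operator on $L^2(\mathbb{R}_+, r^{N-3}\,dr)$. Moreover, conjugation by the unitary operator $\mathcal{F} \circ U_N : L^2(\mathbb{R}_+, r^{N-3}\,dr) \to L^2(\mathbb{R}, d\sigma)$ carries the closures of $$(2\vartheta + N - 2)|_{C_{\mathrm{c}}^\infty(\mathbb{R}_+)}, \qquad i|_{C_{\mathrm{c}}^\infty(\mathbb{R}_+)}, \qquad i(\vartheta - m)(\vartheta + m + N - 2)|_{C_{\mathrm{c}}^\infty(\mathbb{R}_+)}$$ to the operators of multiplication on $L^2(\mathbb{R}, d\sigma)$ by $$2i\sigma, \qquad i, \qquad -i\left(\sigma^2 + \left(m + \tfrac{N-2}{2}\right)^2\right),$$ respectively, where multiplication by a function $\varphi$ has the maximal domain $\{h \in L^2(\mathbb{R}, d\sigma) : \varphi h \in L^2(\mathbb{R}, d\sigma)\}$. -/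

import Mathlib

open MeasureTheory Set Filter TopologicalSpace
open scoped ENNReal LinearPMap Distributions FourierTransform SchwartzMap

noncomputable section

namespace RadialSpectral

/-! ### Unbounded operators on Hilbert spaces -/

/-- A densely defined operator `T` is skew-adjoint if `T† = -T`, including the domain. -/
def IsSkewAdjointOp {H : Type*} [NormedAddCommGroup H] [InnerProductSpace ℂ H] [CompleteSpace H]
    (T : H →ₗ.[ℂ] H) : Prop :=
  Dense (T.domain : Set H) ∧ T† = -T

/-- A densely defined closable operator is essentially skew-adjoint if its closure is
skew-adjoint. -/
def IsEssSkewAdjointOp {H : Type*} [NormedAddCommGroup H] [InnerProductSpace ℂ H]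
    [CompleteSpace H] (T : H →ₗ.[ℂ] H) : Prop :=
  Dense (T.domain : Set H) ∧ T.IsClosable ∧ IsSkewAdjointOp T.closure

/-- The operator `W T W⁻¹` on `K`, with domain `W (dom T)`, to which an unbounded operator `T` on
`H` corresponds via a unitary operator `W : H → K`. -/
def unitaryConj {H K : Type*} [NormedAddCommGroup H] [InnerProductSpace ℂ H]
    [NormedAddCommGroup K] [InnerProductSpace ℂ K]
    (W : H ≃ₗᵢ[ℂ] K) (T : H →ₗ.[ℂ] H) : K →ₗ.[ℂ] K where
  domain := T.domain.comap W.symm.toLinearEquiv.toLinearMap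
  toFun :=
    { toFun := fun y => W (T ⟨W.symm y, y.2⟩)
      map_add' := fun x y => by
        rw [← map_add, ← LinearPMap.map_add]
        congr 2
        exact Subtype.ext (map_add W.symm (x : K) y)
      map_smul' := fun c x => by
        rw [RingHom.id_apply, ← map_smul, ← LinearPMap.map_smul]
        congr 2
        exact Subtype.ext (map_smul W.symm c (x : K)) }

/-- The operator of multiplication by the function `φ` on `L²(ℝ)`, with its maximal domain
`{h ∈ L²(ℝ) | φ h ∈ L²(ℝ)}`. -/
def mulOp (φ : ℝ → ℂ) :
    Lp ℂ 2 (volume : Measure ℝ) →ₗ.[ℂ] Lp ℂ 2 (volume : Measure ℝ) where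
  domain :=
    { carrier := {h | MemLp (fun σ => φ σ * h σ) 2 volume}
      zero_mem' := by
        refine (memLp_congr_ae ?_).mpr (MemLp.zero (ε := ℂ))
        filter_upwards [Lp.coeFn_zero ℂ 2 (volume : Measure ℝ)] with σ hσ
        rw [hσ, Pi.zero_apply, mul_zero]
      add_mem' := fun {f g} hf hg => by
        refine (memLp_congr_ae ?_).mpr (MemLp.add hf hg)
        filter_upwards [Lp.coeFn_add f g] with σ hσ
        rw [hσ, Pi.add_apply, mul_add, Pi.add_apply]
      smul_mem' := fun c f hf => by
        refine (memLp_congr_ae ?_).mpr (MemLp.const_smul hf c)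
        filter_upwards [Lp.coeFn_smul c f] with σ hσ
        simp [hσ, mul_left_comm] }
  toFun :=
    { toFun := fun h => MemLp.toLp _ h.2
      map_add' := fun f g => by
        rw [← MemLp.toLp_add]
        refine MemLp.toLp_congr _ _ ?_
        filter_upwards [Lp.coeFn_add (f : Lp ℂ 2 (volume : Measure ℝ)) g] with σ hσ
        rw [Submodule.coe_add, hσ, Pi.add_apply, mul_add, Pi.add_apply]
      map_smul' := fun c f => by
        rw [RingHom.id_apply, ← MemLp.toLp_const_smul]
        refine MemLp.toLp_congr _ _ ?_
        filter_upwards [Lp.coeFn_smul c (f : Lp ℂ 2 (volume : Measure ℝ))] with σ hσ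
        simp [hσ, mul_left_comm] }

/-! ### Weighted composition operators between `L²` spaces -/

section WeightedComp

variable {α β : Type*} [MeasurableSpace α] [MeasurableSpace β]
  {μ : Measure α} {ν : Measure β} {w : α → ℝ} {φ : α → β} {v : β → ℝ} {ψ : β → α}

lemma ae_of_ae_map (hw : Measurable w) (hw0 : ∀ᵐ x ∂μ, w x ≠ 0)
    (hφ : MeasurePreserving φ (μ.withDensity fun x => ENNReal.ofReal (w x ^ 2)) ν)
    {p : β → Prop} (hp : ∀ᵐ y ∂ν, p y) : ∀ᵐ x ∂μ, p (φ x) := by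
  have hac : μ ≪ μ.withDensity fun x => ENNReal.ofReal (w x ^ 2) := by
    refine withDensity_absolutelyContinuous' (by fun_prop) ?_
    filter_upwards [hw0] with x hx
    simpa using hx
  exact hac.ae_le (hφ.quasiMeasurePreserving.ae hp)

lemma aesm_weightedComp (hw : Measurable w) (hw0 : ∀ᵐ x ∂μ, w x ≠ 0)
    (hφ : MeasurePreserving φ (μ.withDensity fun x => ENNReal.ofReal (w x ^ 2)) ν)
    {f : β → ℂ} (hf : AEStronglyMeasurable f ν) :
    AEStronglyMeasurable (fun x => (w x : ℂ) * f (φ x)) μ := by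
  refine AEStronglyMeasurable.mul ?_ ?_
  · exact (Complex.measurable_ofReal.comp hw).aestronglyMeasurable
  · refine ⟨hf.mk f ∘ φ, hf.stronglyMeasurable_mk.comp_measurable hφ.measurable, ?_⟩
    exact ae_of_ae_map hw hw0 hφ hf.ae_eq_mk

lemma eLpNorm_weightedComp (hw : Measurable w)
    (hφ : MeasurePreserving φ (μ.withDensity fun x => ENNReal.ofReal (w x ^ 2)) ν)
    {f : β → ℂ} (hf : AEStronglyMeasurable f ν) :
    eLpNorm (fun x => (w x : ℂ) * f (φ x)) 2 μ = eLpNorm f 2 ν := by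
  rw [← eLpNorm_comp_measurePreserving hf hφ,
    eLpNorm_eq_lintegral_rpow_enorm_toReal (by norm_num) (by norm_num),
    eLpNorm_eq_lintegral_rpow_enorm_toReal (by norm_num) (by norm_num),
    lintegral_withDensity_eq_lintegral_mul_non_measurable _ (by fun_prop)
      (Eventually.of_forall fun x => ENNReal.ofReal_lt_top)]
  congr 2
  funext x
  have h : ENNReal.ofReal (w x ^ 2) = ‖(w x : ℂ)‖ₑ ^ (2 : ℝ) := by
    rw [← ofReal_norm, ENNReal.ofReal_rpow_of_nonneg (norm_nonneg _) (by norm_num)]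
    simp
  rw [Pi.mul_apply, h, enorm_mul, Function.comp_apply, ENNReal.toReal_ofNat,
    ENNReal.mul_rpow_of_nonneg _ _ (by norm_num)]

lemma memLp_weightedComp (hw : Measurable w) (hw0 : ∀ᵐ x ∂μ, w x ≠ 0)
    (hφ : MeasurePreserving φ (μ.withDensity fun x => ENNReal.ofReal (w x ^ 2)) ν)
    (f : Lp ℂ 2 ν) : MemLp (fun x => (w x : ℂ) * f (φ x)) 2 μ :=
  ⟨aesm_weightedComp hw hw0 hφ (Lp.aestronglyMeasurable f),
    (eLpNorm_weightedComp hw hφ (Lp.aestronglyMeasurable f)).trans_lt (Lp.eLpNorm_lt_top f)⟩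

/-- The isometry `f ↦ w · (f ∘ φ)`. -/
def weightedComp (hw : Measurable w) (hw0 : ∀ᵐ x ∂μ, w x ≠ 0)
    (hφ : MeasurePreserving φ (μ.withDensity fun x => ENNReal.ofReal (w x ^ 2)) ν) :
    Lp ℂ 2 ν →ₗᵢ[ℂ] Lp ℂ 2 μ where
  toFun f := (memLp_weightedComp hw hw0 hφ f).toLp
  map_add' f g := by
    rw [← MemLp.toLp_add]
    refine MemLp.toLp_congr _ _ ?_
    filter_upwards [ae_of_ae_map hw hw0 hφ (Lp.coeFn_add f g)] with x hx
    rw [hx, Pi.add_apply, mul_add, Pi.add_apply]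
  map_smul' c f := by
    rw [RingHom.id_apply, ← MemLp.toLp_const_smul]
    refine MemLp.toLp_congr _ _ ?_
    filter_upwards [ae_of_ae_map hw hw0 hφ (Lp.coeFn_smul c f)] with x hx
    simp [hx, mul_left_comm]
  norm_map' f := by
    change ‖(memLp_weightedComp hw hw0 hφ f).toLp‖ = _
    rw [Lp.norm_toLp, eLpNorm_weightedComp hw hφ (Lp.aestronglyMeasurable f), Lp.norm_def]

lemma weightedComp_coeFn (hw : Measurable w) (hw0 : ∀ᵐ x ∂μ, w x ≠ 0)
    (hφ : MeasurePreserving φ (μ.withDensity fun x => ENNReal.ofReal (w x ^ 2)) ν)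
    (f : Lp ℂ 2 ν) :
    weightedComp hw hw0 hφ f =ᵐ[μ] fun x => (w x : ℂ) * f (φ x) :=
  (memLp_weightedComp hw hw0 hφ f).coeFn_toLp

lemma measurePreserving_inverse (hw : Measurable w) (hv : Measurable v) (hψ : Measurable ψ)
    (hφ : MeasurePreserving φ (μ.withDensity fun x => ENNReal.ofReal (w x ^ 2)) ν)
    (hψφ : ∀ x, ψ (φ x) = x) (hwv : ∀ x, w x * v (φ x) = 1) :
    MeasurePreserving ψ (ν.withDensity fun y => ENNReal.ofReal (v y ^ 2)) μ := by
  refine ⟨hψ, ?_⟩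
  ext s hs
  rw [Measure.map_apply hψ hs, withDensity_apply _ (hψ hs), ← hφ.map_eq,
    setLIntegral_map (hψ hs) (by fun_prop) hφ.measurable]
  have hpre : φ ⁻¹' (ψ ⁻¹' s) = s := by
    ext x
    simp [hψφ]
  rw [hpre, setLIntegral_withDensity_eq_setLIntegral_mul _ (by fun_prop) ?_ hs]
  · rw [← setLIntegral_one]
    refine lintegral_congr fun x => ?_
    rw [Pi.mul_apply, ← ENNReal.ofReal_mul (sq_nonneg _), ← mul_pow, hwv]
    simp
  · have := hφ.measurable
    fun_prop

/-- The unitary operator `f ↦ w · (f ∘ φ)` when `φ` has the left inverse `ψ`. -/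
def weightedCompEquiv (hw : Measurable w) (hv : Measurable v) (hψ : Measurable ψ)
    (hφ : MeasurePreserving φ (μ.withDensity fun x => ENNReal.ofReal (w x ^ 2)) ν)
    (hψφ : ∀ x, ψ (φ x) = x) (hwv : ∀ x, w x * v (φ x) = 1) :
    Lp ℂ 2 ν ≃ₗᵢ[ℂ] Lp ℂ 2 μ :=
  LinearIsometryEquiv.ofSurjective
    (weightedComp hw (ae_of_all _ fun x => left_ne_zero_of_mul_eq_one (hwv x)) hφ) (by
      have hw0 : ∀ᵐ x ∂μ, w x ≠ 0 := ae_of_all _ fun x => left_ne_zero_of_mul_eq_one (hwv x)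
      have hv0 : ∀ᵐ y ∂ν, v y ≠ 0 := by
        have hm : MeasurableSet {y | v y ≠ 0} := (measurableSet_eq_fun hv measurable_const).compl
        rw [← hφ.map_eq, ae_map_iff hφ.measurable.aemeasurable hm]
        exact ae_of_all _ fun x => right_ne_zero_of_mul_eq_one (hwv x)
      have hψ' := measurePreserving_inverse hw hv hψ hφ hψφ hwv
      intro g
      refine ⟨weightedComp hv hv0 hψ' g, Lp.ext ?_⟩
      filter_upwards [weightedComp_coeFn hw hw0 hφ (weightedComp hv hv0 hψ' g),
        ae_of_ae_map hw hw0 hφ (weightedComp_coeFn hv hv0 hψ' g)] with x h1 h2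
      rw [h1, h2, hψφ, ← mul_assoc, ← Complex.ofReal_mul, hwv, Complex.ofReal_one, one_mul])

lemma weightedCompEquiv_coeFn (hw : Measurable w) (hv : Measurable v) (hψ : Measurable ψ)
    (hφ : MeasurePreserving φ (μ.withDensity fun x => ENNReal.ofReal (w x ^ 2)) ν)
    (hψφ : ∀ x, ψ (φ x) = x) (hwv : ∀ x, w x * v (φ x) = 1) (f : Lp ℂ 2 ν) :
    weightedCompEquiv hw hv hψ hφ hψφ hwv f =ᵐ[μ] fun x => (w x : ℂ) * f (φ x) :=
  weightedComp_coeFn hw (ae_of_all _ fun x => left_ne_zero_of_mul_eq_one (hwv x)) hφ f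

end WeightedComp

/-! ### The space `L²(ℝ₊, r^(N-3) dr)` and the unitary operators `U_N` and `𝓕` -/

/-- The measure `r^(N-3) dr` on `ℝ₊ = (0, ∞)`, as a measure on `ℝ` carried by `(0, ∞)`. -/
def radialMeasure (N : ℕ) : Measure ℝ :=
  (volume.restrict (Ioi 0)).withDensity fun r => ENNReal.ofReal (r ^ ((N : ℤ) - 3))

lemma measurePreserving_exp (N : ℕ) :
    MeasurePreserving Real.exp
      (volume.withDensity fun s : ℝ => ENNReal.ofReal (Real.exp (((N : ℝ) - 2) / 2 * s) ^ 2))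
      (radialMeasure N) := by
  refine ⟨Real.measurable_exp, ?_⟩
  ext A hA
  rw [Measure.map_apply Real.measurable_exp hA,
    withDensity_apply _ (Real.measurable_exp hA), radialMeasure, withDensity_apply _ hA,
    Measure.restrict_restrict hA]
  have himg : A ∩ Ioi 0 = Real.exp '' (Real.exp ⁻¹' A) := by
    rw [image_preimage_eq_inter_range, Real.range_exp]
  rw [himg, lintegral_image_eq_lintegral_abs_deriv_mul (Real.measurable_exp hA)
    (fun x _ => (Real.hasDerivAt_exp x).hasDerivWithinAt) Real.exp_injective.injOn]
  refine lintegral_congr fun s => ?_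
  rw [← ENNReal.ofReal_mul (abs_nonneg _), abs_of_pos (Real.exp_pos s),
    ← Real.rpow_intCast, ← Real.exp_mul, ← Real.exp_nat_mul, ← Real.exp_add]
  congr 2
  push_cast
  ring

/-- The unitary operator `U_N f (s) = e^((N-2)s/2) f(e^s)` from `L²(ℝ₊, r^(N-3) dr)` to
`L²(ℝ, ds)`. -/
def radialU (N : ℕ) : Lp ℂ 2 (radialMeasure N) ≃ₗᵢ[ℂ] Lp ℂ 2 (volume : Measure ℝ) :=
  weightedCompEquiv (w := fun s => Real.exp (((N : ℝ) - 2) / 2 * s)) (φ := Real.exp)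
    (v := fun r => Real.exp (-(((N : ℝ) - 2) / 2 * Real.log r))) (ψ := Real.log)
    (by fun_prop) (by fun_prop) Real.measurable_log (measurePreserving_exp N) Real.log_exp
    (fun s => by rw [Real.log_exp, ← Real.exp_add, add_neg_cancel, Real.exp_zero])

lemma radialU_coeFn (N : ℕ) (f : Lp ℂ 2 (radialMeasure N)) :
    radialU N f =ᵐ[volume]
      fun s => (Real.exp (((N : ℝ) - 2) / 2 * s) : ℂ) * f (Real.exp s) :=
  weightedCompEquiv_coeFn _ _ _ _ _ _ f

lemma measurePreserving_dilation :
    MeasurePreserving (fun σ : ℝ => (2 * Real.pi)⁻¹ * σ)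
      (volume.withDensity fun _ : ℝ => ENNReal.ofReal ((Real.sqrt (2 * Real.pi))⁻¹ ^ 2))
      volume := by
  refine ⟨by fun_prop, ?_⟩
  have hpi : (0 : ℝ) < 2 * Real.pi := by positivity
  rw [withDensity_const, Measure.map_smul, inv_pow, Real.sq_sqrt hpi.le]
  have h := Real.smul_map_volume_mul_left (a := (2 * Real.pi)⁻¹) (by positivity)
  rwa [abs_of_pos (by positivity)] at h

/-- The unitary operator `h ↦ (2π)^(-1/2) h(σ/2π)` on `L²(ℝ)`. -/
def dilation : Lp ℂ 2 (volume : Measure ℝ) ≃ₗᵢ[ℂ] Lp ℂ 2 (volume : Measure ℝ) :=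
  weightedCompEquiv (w := fun _ => (Real.sqrt (2 * Real.pi))⁻¹)
    (φ := fun σ => (2 * Real.pi)⁻¹ * σ)
    (v := fun _ => Real.sqrt (2 * Real.pi)) (ψ := fun ξ => (2 * Real.pi) * ξ)
    (by fun_prop) (by fun_prop) (by fun_prop) measurePreserving_dilation
    (fun σ => mul_inv_cancel_left₀ (by positivity) σ)
    (fun _ => inv_mul_cancel₀ (by positivity))

/-- The Fourier transform `𝓕 g (σ) = (2π)^(-1/2) ∫ g(s) e^(-iσs) ds` as a unitary operator on
`L²(ℝ)`. Mathlib's transform has the kernel `e^(-2πiξs)`, hence the dilation. -/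
def fourierL2 : Lp ℂ 2 (volume : Measure ℝ) ≃ₗᵢ[ℂ] Lp ℂ 2 (volume : Measure ℝ) :=
  (Lp.fourierTransformₗᵢ ℝ ℂ).trans dilation

/-- On Schwartz functions, `fourierL2` is given by the integral formula. -/
lemma fourierL2_schwartz (g : 𝓢(ℝ, ℂ)) :
    fourierL2 (g.toLp 2) =ᵐ[volume] fun σ =>
      ((Real.sqrt (2 * Real.pi))⁻¹ : ℂ) * ∫ s : ℝ, g s * Complex.exp (-Complex.I * σ * s) := by
  have h1 : fourierL2 (g.toLp 2) = dilation ((𝓕 g).toLp 2) :=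
    congrArg dilation (SchwartzMap.toLp_fourier_eq g)
  rw [h1]
  have h2 := weightedCompEquiv_coeFn (w := fun _ => (Real.sqrt (2 * Real.pi))⁻¹)
    (φ := fun σ => (2 * Real.pi)⁻¹ * σ)
    (v := fun _ => Real.sqrt (2 * Real.pi)) (ψ := fun ξ => (2 * Real.pi) * ξ)
    (by fun_prop) (by fun_prop) (by fun_prop) measurePreserving_dilation
    (fun σ => mul_inv_cancel_left₀ (by positivity) σ)
    (fun _ => inv_mul_cancel₀ (by positivity)) ((𝓕 g).toLp 2)
  have h3 := ae_of_ae_map (by fun_prop) (ae_of_all _ fun _ => by positivity)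
    measurePreserving_dilation ((𝓕 g).coeFn_toLp 2 volume)
  filter_upwards [h2, h3] with σ h2 h3
  refine h2.trans ?_
  rw [h3, SchwartzMap.fourier_coe, Real.fourier_real_eq_integral_exp_smul]
  congr 1
  · push_cast
    rfl
  · refine integral_congr_ae (ae_of_all _ fun s => ?_)
    have hpi : (Real.pi : ℂ) ≠ 0 := by exact_mod_cast Real.pi_ne_zero
    simp only [smul_eq_mul]
    rw [mul_comm]
    congr 2
    push_cast
    field_simp

/-! ### Differential operators on `C_c^∞(ℝ₊)` -/

/-- `ℝ₊ = (0, ∞)` as an open subset of `ℝ`. -/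
def posReals : Opens ℝ := ⟨Ioi 0, isOpen_Ioi⟩

/-- The Euler operator `ϑ = r d/dr` on `C_c^∞(ℝ₊)`. -/
def euler : Module.End ℂ 𝓓(posReals, ℂ) where
  toFun f :=
    { toFun := fun r => (r : ℂ) * deriv f r
      contDiff' := by
        refine Complex.ofRealCLM.contDiff.mul ?_
        exact ((contDiff_infty_iff_deriv (𝕜 := ℝ)).mp f.contDiff).2
      hasCompactSupport' := f.hasCompactSupport.deriv.mul_left
      tsupport_subset' := (tsupport_mul_subset_right.trans (closure_minimal
        support_deriv_subset (isClosed_tsupport f))).trans f.tsupport_subset }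
  map_add' f g := by
    ext r
    have hf : DifferentiableAt ℝ f r := f.contDiff.differentiable (by simp) r
    have hg : DifferentiableAt ℝ g r := g.contDiff.differentiable (by simp) r
    change (r : ℂ) * deriv (⇑f + ⇑g) r = (r : ℂ) * deriv f r + (r : ℂ) * deriv g r
    rw [deriv_add hf hg, mul_add]
  map_smul' c f := by
    ext r
    have hf : DifferentiableAt ℝ f r := f.contDiff.differentiable (by simp) r
    change (r : ℂ) * deriv (c • ⇑f) r = c * ((r : ℂ) * deriv f r)
    rw [deriv_const_smul c hf, smul_eq_mul, mul_left_comm]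

/-- The operator `2ϑ + N - 2`. -/
def opH (N : ℕ) : Module.End ℂ 𝓓(posReals, ℂ) :=
  (2 : ℂ) • euler + ((N : ℂ) - 2) • 1

/-- The operator `i`. -/
def opI : Module.End ℂ 𝓓(posReals, ℂ) := Complex.I • 1

/-- The operator `i (ϑ - m) (ϑ + m + N - 2)`. -/
def opE (N m : ℕ) : Module.End ℂ 𝓓(posReals, ℂ) :=
  Complex.I • ((euler - (m : ℂ) • 1) * (euler + ((m : ℂ) + (N : ℂ) - 2) • 1))

/-- The real span of `2ϑ + N - 2`, `i` and `i (ϑ - m) (ϑ + m + N - 2)`. -/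
def gRad (N m : ℕ) : Submodule ℝ (Module.End ℂ 𝓓(posReals, ℂ)) :=
  Submodule.span ℝ {opH N, opI, opE N m}

/-! ### The unbounded operators on `L²(ℝ₊, r^(N-3) dr)` -/

lemma memLp_testFunction (N : ℕ) (f : 𝓓(posReals, ℂ)) : MemLp f 2 (radialMeasure N) := by
  have hK : IsCompact (tsupport f) := f.hasCompactSupport
  have hKm : MeasurableSet (tsupport f) := hK.isClosed.measurableSet
  have hsub : tsupport f ⊆ Ioi 0 := f.tsupport_subset
  have hint : IntegrableOn (fun r : ℝ => r ^ ((N : ℤ) - 3)) (tsupport f) := by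
    refine ContinuousOn.integrableOn_compact hK fun r hr => ?_
    exact (continuousAt_zpow₀ r _ (Or.inl (ne_of_gt (hsub hr)))).continuousWithinAt
  have hfin : radialMeasure N (tsupport f) < ∞ := by
    rw [radialMeasure, withDensity_apply _ hKm, Measure.restrict_restrict hKm,
      inter_eq_left.mpr hsub]
    refine lt_of_le_of_lt (lintegral_mono fun r => ?_) hint.2
    exact Real.ofReal_le_enorm _
  have hind : (tsupport f).indicator f = f :=
    indicator_eq_self.mpr (subset_tsupport f)
  rw [← hind, memLp_indicator_iff_restrict hKm]
  have : IsFiniteMeasure ((radialMeasure N).restrict (tsupport f)) :=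
    ⟨by rwa [Measure.restrict_apply_univ]⟩
  obtain ⟨C, hC⟩ := f.hasCompactSupport.exists_bound_of_continuous f.continuous
  exact MemLp.of_bound f.continuous.aestronglyMeasurable C (ae_of_all _ hC)

/-- The map from `C_c^∞(ℝ₊)` to `L²(ℝ₊, r^(N-3) dr)` sending a function to its class. -/
def testToL2 (N : ℕ) : 𝓓(posReals, ℂ) →ₗ[ℂ] Lp ℂ 2 (radialMeasure N) where
  toFun f := (memLp_testFunction N f).toLp f
  map_add' _ _ := rfl
  map_smul' _ _ := rfl

lemma testToL2_injective (N : ℕ) : Function.Injective (testToL2 N) := by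
  intro f g hfg
  have hae : f =ᵐ[radialMeasure N] g :=
    (MemLp.toLp_eq_toLp_iff (memLp_testFunction N f) (memLp_testFunction N g)).mp hfg
  have hac : (volume : Measure ℝ).restrict (Ioi 0) ≪ radialMeasure N := by
    refine withDensity_absolutelyContinuous' (by fun_prop) ?_
    filter_upwards [ae_restrict_mem measurableSet_Ioi] with r hr
    simpa using zpow_pos hr _
  have heq : EqOn f g (Ioi 0) := Measure.eqOn_open_of_ae_eq (hac.ae_le hae) isOpen_Ioi
    f.continuous.continuousOn g.continuous.continuousOn
  ext r
  by_cases hr : r ∈ Ioi (0 : ℝ)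
  · exact heq hr
  · rw [image_eq_zero_of_notMem_tsupport fun h => hr (f.tsupport_subset h),
      image_eq_zero_of_notMem_tsupport fun h => hr (g.tsupport_subset h)]

/-- The unbounded operator on `L²(ℝ₊, r^(N-3) dr)` with domain `C_c^∞(ℝ₊)` given by `D`. -/
def radialOp (N : ℕ) (D : Module.End ℂ 𝓓(posReals, ℂ)) :
    Lp ℂ 2 (radialMeasure N) →ₗ.[ℂ] Lp ℂ 2 (radialMeasure N) where
  domain := LinearMap.range (testToL2 N)
  toFun := testToL2 N ∘ₗ D ∘ₗ
    (LinearEquiv.ofInjective (testToL2 N) (testToL2_injective N)).symm.toLinearMap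

lemma radialOp_testToL2 (N : ℕ) (D : Module.End ℂ 𝓓(posReals, ℂ)) (f : 𝓓(posReals, ℂ)) :
    radialOp N D ⟨testToL2 N f, f, rfl⟩ = testToL2 N (D f) :=
  congrArg (fun g => testToL2 N (D g))
    ((LinearEquiv.ofInjective (testToL2 N) (testToL2_injective N)).symm_apply_apply f)

end RadialSpectral

end

/-! Put $k = (N-2)/2$ and $E = \vartheta + k$. The operator $U_N$ turns $E$ into $d/ds$ and maps
$C_c^\infty(\mathbb{R}_+)$ onto $C_c^\infty(\mathbb{R})$, and $(\vartheta-m)(\vartheta+m+N-2) =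
E^2-(m+k)^2$. So every $D$ in the span is $\alpha E^2+\beta E+\gamma$ with $\alpha,\gamma$ imaginary
and $\beta$ real, and after the Fourier transform it is multiplication by
$\varphi(\sigma)=\alpha(i\sigma)^2+\beta(i\sigma)+\gamma$, which takes imaginary values. Such a
multiplication operator $M_\varphi$ is skew-adjoint because $(\varphi\mp1)^{-1}$ is bounded.

What remains is that the transformed test functions form a core of $M_\varphi$. Two approximations
in the graph norm give this. Schwartz functions are a core, since $(\varphi-1)^{-1}$ preserves
$C_c^\infty$ and the graph norm is controlled by $M_\varphi-1$ (`graph_mulOp_subset_closure`). On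
the other side of the Fourier transform, cutoffs approximate a Schwartz function together with two
derivatives (`exists_tendsto_compactSupport`). Both meet in `radialOp_eulerPoly_closure`, which
identifies the closure; essential skew-adjointness is then transported back along the unitary. -/

noncomputable section

namespace RadialSpectral

/-! ### Skew-adjointness from surjectivity of `T ± 1` -/

section Abstract

variable {H K : Type*} [NormedAddCommGroup H] [InnerProductSpace ℂ H]
  [NormedAddCommGroup K] [InnerProductSpace ℂ K]

/-- `T` is skew-symmetric, and `T - 1` and `T + 1` are surjective. -/
structure IsMaximalSkew (T : H →ₗ.[ℂ] H) : Prop where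
  skew : ∀ p ∈ T.graph, ∀ q ∈ T.graph, inner ℂ p.2 q.1 = -inner ℂ p.1 q.2
  surj_sub : ∀ u, ∃ p ∈ T.graph, p.2 - p.1 = u
  surj_add : ∀ u, ∃ p ∈ T.graph, p.2 + p.1 = u

/-- Skewness makes $\langle Tx,x\rangle$ purely imaginary, so the cross term drops out. -/
lemma IsMaximalSkew.norm_sub_sq {T : H →ₗ.[ℂ] H} (hT : IsMaximalSkew T) {p : H × H}
    (hp : p ∈ T.graph) : ‖p.2 - p.1‖ ^ 2 = ‖p.2‖ ^ 2 + ‖p.1‖ ^ 2 := by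
  have h1 := congrArg Complex.re (hT.skew p hp p hp)
  have h2 : (inner ℂ p.2 p.1).re = (inner ℂ p.1 p.2).re := inner_re_symm (𝕜 := ℂ) p.2 p.1
  have h3 : ‖p.2 - p.1‖ ^ 2 = ‖p.2‖ ^ 2 - 2 * (inner ℂ p.2 p.1).re + ‖p.1‖ ^ 2 :=
    _root_.norm_sub_sq (𝕜 := ℂ) p.2 p.1
  rw [Complex.neg_re] at h1
  linarith

/-- Approximating $(T-1)x$ in norm therefore approximates $x$ in the graph norm. -/
lemma IsMaximalSkew.norm_le {T : H →ₗ.[ℂ] H} (hT : IsMaximalSkew T) {p : H × H}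
    (hp : p ∈ T.graph) : ‖p‖ ≤ ‖p.2 - p.1‖ := by
  have h := hT.norm_sub_sq hp
  refine max_le (abs_le_of_sq_le_sq' ?_ (norm_nonneg _)).2
    (abs_le_of_sq_le_sq' ?_ (norm_nonneg _)).2
  · linarith [sq_nonneg ‖p.2‖]
  · linarith [sq_nonneg ‖p.1‖]

lemma IsMaximalSkew.dense_domain [CompleteSpace H] {T : H →ₗ.[ℂ] H} (hT : IsMaximalSkew T) :
    Dense (T.domain : Set H) := by
  rw [Submodule.dense_iff_topologicalClosure_eq_top, Submodule.topologicalClosure_eq_top_iff,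
    Submodule.eq_bot_iff]
  intro u hu
  -- Write $u=Tx-x$. Pythagoras with $u\perp x$ gives $\|Tx\|^2=\|u\|^2+\|x\|^2$, while
  -- `norm_sub_sq` gives $\|u\|^2=\|Tx\|^2+\|x\|^2$; hence $x=0$.
  obtain ⟨p, hp, rfl⟩ := hT.surj_sub u
  have h0 := (Submodule.mem_orthogonal' _ _).mp hu p.1 (LinearPMap.mem_domain_of_mem_graph hp)
  have h1 : ‖p.2‖ ^ 2 = ‖p.2 - p.1‖ ^ 2 + ‖p.1‖ ^ 2 := by
    have h2 := norm_add_sq (𝕜 := ℂ) (p.2 - p.1) p.1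
    rw [h0, sub_add_cancel] at h2
    simpa using h2
  have h2 : p.1 = 0 := by
    rw [← norm_eq_zero, ← sq_eq_zero_iff]
    linarith [hT.norm_sub_sq hp]
  rw [h2, LinearPMap.graph_fst_eq_zero_snd T hp h2, sub_zero]

lemma IsMaximalSkew.adjoint_eq_neg [CompleteSpace H] {T : H →ₗ.[ℂ] H} (hT : IsMaximalSkew T) :
    T† = -T := by
  have hd := hT.dense_domain
  have hle : -T ≤ T† := by
    refine LinearPMap.IsFormalAdjoint.le_adjoint hd fun x y => ?_
    rw [LinearPMap.neg_apply, inner_neg_right]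
    exact hT.skew _ (T.mem_graph x) _ (T.mem_graph y)
  refine (LinearPMap.eq_of_le_of_domain_eq hle (le_antisymm hle.1 fun y hy => ?_)).symm
  -- With $Tx+x=y-T^*y$ and $T^*x=-Tx$, the vector $y-x$ satisfies $T^*(y-x)=y-x$. It is thus
  -- orthogonal to the range of $T-1$, which is everything, so $y=x$ lies in the domain of $T$.
  obtain ⟨⟨x, v⟩, hx, hxv⟩ := hT.surj_add (y - T† ⟨y, hy⟩)
  simp only at hxv
  have hw : ∀ q ∈ T.graph, inner ℂ (y - x) (q.2 - q.1) = 0 := by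
    intro q hq
    have h1 := hT.skew _ hx q hq
    obtain ⟨z, hz1, hz2⟩ := (LinearPMap.mem_graph_iff _).mp hq
    have h2 := LinearPMap.adjoint_isFormalAdjoint hd ⟨y, hy⟩ z
    rw [hz1, hz2] at h2
    simp only at h1 h2
    have h3 : T† ⟨y, hy⟩ = y - x - v := by
      rw [← sub_eq_zero, ← sub_eq_zero.mpr hxv]
      abel
    rw [h3, inner_sub_left, inner_sub_left] at h2
    rw [inner_sub_left, inner_sub_right, inner_sub_right]
    linear_combination -h2 - h1
  obtain ⟨q, hq, hqw⟩ := hT.surj_sub (y - x)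
  have h4 := hw q hq
  rw [hqw, inner_self_eq_zero, sub_eq_zero] at h4
  rw [h4, LinearPMap.neg_domain]
  exact LinearPMap.mem_domain_of_mem_graph hx

lemma IsMaximalSkew.isSkewAdjointOp [CompleteSpace H] {T : H →ₗ.[ℂ] H} (hT : IsMaximalSkew T) :
    IsSkewAdjointOp T :=
  ⟨hT.dense_domain, hT.adjoint_eq_neg⟩

lemma IsMaximalSkew.isClosed [CompleteSpace H] {T : H →ₗ.[ℂ] H} (hT : IsMaximalSkew T) :
    T.IsClosed := by
  have h1 : T†.IsClosed := LinearPMap.adjoint_isClosed hT.dense_domain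
  rw [hT.adjoint_eq_neg] at h1
  have h2 : (T.graph : Set (H × H)) = (fun p : H × H => (p.1, -p.2)) ⁻¹' ((-T).graph : Set _) := by
    ext ⟨x, y⟩
    simp only [SetLike.mem_coe, mem_preimage, LinearPMap.mem_graph_iff]
    refine exists_congr fun z => and_congr Iff.rfl ?_
    rw [LinearPMap.neg_apply, neg_inj]
  rw [LinearPMap.IsClosed, h2]
  exact IsClosed.preimage (by fun_prop) h1

lemma mem_graph_unitaryConj (W : H ≃ₗᵢ[ℂ] K) (T : H →ₗ.[ℂ] H) (p : K × K) :
    p ∈ (unitaryConj W T).graph ↔ (W.symm p.1, W.symm p.2) ∈ T.graph := by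
  obtain ⟨x, y⟩ := p
  simp only [LinearPMap.mem_graph_iff]
  constructor
  · rintro ⟨z, rfl, hz⟩
    refine ⟨⟨W.symm z, z.2⟩, rfl, ?_⟩
    rw [← hz]
    exact (W.symm_apply_apply _).symm
  · rintro ⟨z, hz1, hz2⟩
    refine ⟨⟨x, ?_⟩, rfl, ?_⟩
    · change W.symm x ∈ T.domain
      rw [← hz1]
      exact z.2
    · rw [← W.apply_symm_apply y, ← hz2]
      change W (T ⟨W.symm x, _⟩) = _
      congr 2
      exact Subtype.ext hz1.symm

lemma IsMaximalSkew.of_unitaryConj {W : H ≃ₗᵢ[ℂ] K} {T : H →ₗ.[ℂ] H}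
    (hT : IsMaximalSkew (unitaryConj W T)) : IsMaximalSkew T := by
  have hmem : ∀ p ∈ T.graph, (W p.1, W p.2) ∈ (unitaryConj W T).graph := fun p hp => by
    rwa [mem_graph_unitaryConj, W.symm_apply_apply, W.symm_apply_apply]
  refine ⟨fun p hp q hq => ?_, fun u => ?_, fun u => ?_⟩
  · simpa using hT.skew _ (hmem p hp) _ (hmem q hq)
  · obtain ⟨p, hp, hu⟩ := hT.surj_sub (W u)
    refine ⟨_, (mem_graph_unitaryConj W T p).mp hp, ?_⟩
    rw [← map_sub, hu, W.symm_apply_apply]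
  · obtain ⟨p, hp, hu⟩ := hT.surj_add (W u)
    refine ⟨_, (mem_graph_unitaryConj W T p).mp hp, ?_⟩
    rw [← map_add, hu, W.symm_apply_apply]

lemma prod_map_mem_closure (W : H ≃ₗᵢ[ℂ] K) {s : Set (H × H)} {T : K →ₗ.[ℂ] K} {p : H × H}
    (hp : p ∈ closure s) (hs : ∀ q ∈ s, (W q.1, W q.2) ∈ T.graph) :
    (W p.1, W p.2) ∈ T.graph.topologicalClosure := by
  rw [← SetLike.mem_coe, Submodule.topologicalClosure_coe]
  exact map_mem_closure (f := fun q : H × H => (W q.1, W q.2))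
    ((W.continuous.comp continuous_fst).prodMk (W.continuous.comp continuous_snd)) hp hs

/-- If `M` is closed and `W T W⁻¹` is a restriction of `M` whose graph is dense in that of `M`,
then `T` is closable and `W` carries the closure of `T` to `M`. -/
lemma unitaryConj_closure_eq (W : H ≃ₗᵢ[ℂ] K) (T : H →ₗ.[ℂ] H) {M : K →ₗ.[ℂ] K}
    (hM : M.IsClosed) (hTM : (unitaryConj W T).graph ≤ M.graph)
    (hMT : M.graph ≤ (unitaryConj W T).graph.topologicalClosure) :
    T.IsClosable ∧ unitaryConj W T.closure = M := by
  let e : K × K ≃ₜ H × H :=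
    W.symm.toHomeomorph.prodCongr W.symm.toHomeomorph
  have hgraph : ∀ S : H →ₗ.[ℂ] H,
      ((unitaryConj W S).graph : Set (K × K)) = e ⁻¹' (S.graph : Set (H × H)) := fun S => by
    ext p
    exact mem_graph_unitaryConj W S p
  have hMS : unitaryConj W (unitaryConj W.symm M) = M := by
    refine LinearPMap.eq_of_eq_graph (SetLike.ext fun p => ?_)
    rw [mem_graph_unitaryConj, mem_graph_unitaryConj, W.symm_symm, W.apply_symm_apply,
      W.apply_symm_apply]
  -- $W^{-1}MW$ is a closed extension of $T$, which gives closability.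
  have hS : (unitaryConj W.symm M).IsClosed := by
    have h := hM
    rw [← hMS, LinearPMap.IsClosed, hgraph, e.isClosed_preimage] at h
    exact h
  have hclos : T.IsClosable := by
    refine hS.isClosable.leIsClosable (LinearPMap.le_of_le_graph fun p hp => ?_)
    rw [mem_graph_unitaryConj]
    exact hTM ((mem_graph_unitaryConj W T _).mpr (by
      rwa [W.symm_symm, W.symm_apply_apply, W.symm_apply_apply]))
  have hcl : (unitaryConj W T.closure).graph = (unitaryConj W T).graph.topologicalClosure := by
    refine SetLike.coe_injective ?_
    rw [Submodule.topologicalClosure_coe, hgraph, hgraph, ← e.preimage_closure,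
      ← hclos.graph_closure_eq_closure_graph, Submodule.topologicalClosure_coe]
  refine ⟨hclos, LinearPMap.eq_of_eq_graph (le_antisymm ?_ (hMT.trans hcl.ge))⟩
  rw [hcl]
  exact Submodule.topologicalClosure_minimal _ hTM hM

end Abstract

/-! ### Multiplication operators by imaginary functions -/

section MulOp

variable {φ : ℝ → ℂ}

/-- The maximal domain needs no separate condition: $\varphi h$ agrees almost everywhere with $k$,
which is already in $L^2$. -/
lemma mem_graph_mulOp {h k : Lp ℂ 2 (volume : Measure ℝ)} :
    (h, k) ∈ (mulOp φ).graph ↔ k =ᵐ[volume] fun σ => φ σ * h σ := by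
  rw [LinearPMap.mem_graph_iff]
  constructor
  · rintro ⟨y, rfl, rfl⟩
    exact MemLp.coeFn_toLp (f := fun σ => φ σ * (y : Lp ℂ 2 (volume : Measure ℝ)) σ) y.2
  · intro hk
    have hmem : MemLp (fun σ => φ σ * h σ) 2 volume := (memLp_congr_ae hk).mp (Lp.memLp k)
    exact ⟨⟨h, hmem⟩, rfl, Lp.ext (hmem.coeFn_toLp.trans hk.symm)⟩

lemma one_le_norm_sub {z c : ℂ} (hz : z.re = 0) (hc : |c.re| = 1) : 1 ≤ ‖z - c‖ := by
  have h := Complex.abs_re_le_norm (z - c)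
  rwa [Complex.sub_re, hz, zero_sub, abs_neg, hc] at h

/-- The resolvent is multiplication by $(\varphi-c)^{-1}$, of modulus at most 1. The explicit
formula for the solution is kept because its smoothness and support matter for the core argument. -/
lemma exists_mem_graph_mulOp_sub (hφ : Measurable φ) (him : ∀ σ, (φ σ).re = 0) {c : ℂ}
    (hc : |c.re| = 1) (u : Lp ℂ 2 (volume : Measure ℝ)) :
    ∃ p ∈ (mulOp φ).graph, p.2 - c • p.1 = u ∧ p.1 =ᵐ[volume] fun σ => (φ σ - c)⁻¹ * u σ := by
  have hh : MemLp (fun σ => (φ σ - c)⁻¹ * u σ) 2 volume := by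
    refine MemLp.mono (Lp.memLp u)
      (((hφ.sub_const c).inv.aestronglyMeasurable).mul (Lp.aestronglyMeasurable u))
      (ae_of_all _ fun σ => ?_)
    rw [norm_mul, norm_inv]
    exact mul_le_of_le_one_left (norm_nonneg _) (inv_le_one_of_one_le₀ (one_le_norm_sub (him σ) hc))
  refine ⟨(hh.toLp, u + c • hh.toLp), mem_graph_mulOp.mpr ?_, add_sub_cancel_right _ _,
    hh.coeFn_toLp⟩
  filter_upwards [Lp.coeFn_add u (c • hh.toLp), Lp.coeFn_smul c hh.toLp, hh.coeFn_toLp]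
    with σ h1 h2 h3
  rw [h1, Pi.add_apply, h2, Pi.smul_apply, h3, smul_eq_mul]
  have h4 : φ σ - c ≠ 0 := norm_pos_iff.mp (one_pos.trans_le (one_le_norm_sub (him σ) hc))
  field_simp
  ring

lemma isMaximalSkew_mulOp (hφ : Measurable φ) (him : ∀ σ, (φ σ).re = 0) :
    IsMaximalSkew (mulOp φ) := by
  refine ⟨fun p hp q hq => ?_, fun u => ?_, fun u => ?_⟩
  · rw [L2.inner_def, L2.inner_def, ← integral_neg]
    refine integral_congr_ae ?_
    filter_upwards [mem_graph_mulOp.mp hp, mem_graph_mulOp.mp hq] with σ h1 h2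
    have h3 : (starRingEnd ℂ) (φ σ) = -φ σ := by
      apply Complex.ext <;> simp [him σ]
    rw [h1, h2, RCLike.inner_apply, RCLike.inner_apply, map_mul, h3]
    ring
  · obtain ⟨p, hp, h1, -⟩ := exists_mem_graph_mulOp_sub hφ him (c := 1) (by simp) u
    exact ⟨p, hp, by rwa [one_smul] at h1⟩
  · obtain ⟨p, hp, h1, -⟩ := exists_mem_graph_mulOp_sub hφ him (c := -1) (by simp) u
    exact ⟨p, hp, by rwa [neg_smul, one_smul, sub_neg_eq_add] at h1⟩

end MulOp

/-! ### Density of smooth vectors in the graph of a multiplication operator -/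

lemma graph_mulOp_subset_closure {φ : ℝ → ℂ} (hφ : ContDiff ℝ (⊤ : ℕ∞) φ)
    (him : ∀ σ, (φ σ).re = 0) :
    ((mulOp φ).graph : Set _) ⊆
      closure {p | p ∈ (mulOp φ).graph ∧ ∃ k : 𝓢(ℝ, ℂ), p.1 = k.toLp 2 volume} := by
  intro p hp
  have hT := isMaximalSkew_mulOp hφ.continuous.measurable him
  rw [Metric.mem_closure_iff]
  intro ε hε
  -- Approximate $(M_\varphi-1)p_1$, not $p_1$ itself, by a smooth compactly supported $g$; the
  -- resolvent then gives a smooth compactly supported approximant of $p_1$ in the graph norm.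
  obtain ⟨u, ⟨g, hug, hg1, hg2⟩, hu⟩ := Metric.dense_iff.mp
    (Lp.dense_hasCompactSupport_contDiff (F := ℂ) (μ := (volume : Measure ℝ)) (p := 2)
      (by norm_num)) (p.2 - p.1) ε hε |>.imp fun u hu => And.intro hu.2 hu.1
  obtain ⟨q, hq, hq1, hq2⟩ := exists_mem_graph_mulOp_sub hφ.continuous.measurable him
    (c := 1) (by simp) u
  rw [one_smul] at hq1
  refine ⟨q, ⟨hq, ?_⟩, ?_⟩
  · have hne : ∀ σ, φ σ - 1 ≠ 0 := fun σ =>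
      norm_pos_iff.mp (one_pos.trans_le (one_le_norm_sub (him σ) (by simp)))
    have hc : HasCompactSupport fun σ => (φ σ - 1)⁻¹ * g σ := hg1.mul_left
    refine ⟨hc.toSchwartzMap (((hφ.sub contDiff_const).inv hne).mul hg2), Lp.ext ?_⟩
    filter_upwards [hq2, hug, SchwartzMap.coeFn_toLp (hc.toSchwartzMap
      (((hφ.sub contDiff_const).inv hne).mul hg2)) 2 volume] with σ h1 h2 h3
    rw [h1, h2, h3]
    rfl
  · rw [dist_eq_norm]
    refine (hT.norm_le (sub_mem hp hq)).trans_lt ?_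
    rw [Metric.mem_ball, dist_comm, dist_eq_norm, ← hq1] at hu
    have hpq : (p - q).2 - (p - q).1 = p.2 - p.1 - (q.2 - q.1) := sub_sub_sub_comm _ _ _ _
    rwa [hpq]

/-! ### Approximation of Schwartz functions by compactly supported ones -/

/-- Dominated convergence: at each point all but finitely many terms vanish. -/
lemma tendsto_toLp_zero {d : ℕ → 𝓢(ℝ, ℂ)} {G : ℝ → ℝ} (hG : MemLp G 2 volume)
    (hdG : ∀ n s, ‖d n s‖ ≤ G s) (hd0 : ∀ (n : ℕ) (s : ℝ), |s| < n → d n s = 0) :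
    Tendsto (fun n => (d n).toLp 2 (volume : Measure ℝ)) atTop (nhds 0) := by
  rw [tendsto_zero_iff_norm_tendsto_zero]
  simp_rw [SchwartzMap.norm_toLp]
  rw [← ENNReal.toReal_zero]
  refine (ENNReal.tendsto_toReal ENNReal.zero_ne_top).comp ?_
  simp_rw [eLpNorm_eq_lintegral_rpow_enorm_toReal (p := 2) two_ne_zero ENNReal.ofNat_ne_top]
  have h0 : (0 : ℝ≥0∞) = (∫⁻ _ : ℝ, 0) ^ (1 / (2 : ℝ≥0∞).toReal) := by simp
  rw [h0]
  refine ((ENNReal.continuous_rpow_const (y := 1 / (2 : ℝ≥0∞).toReal)).tendsto _).comp ?_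
  refine tendsto_lintegral_of_dominated_convergence
    (fun s => ‖G s‖ₑ ^ (2 : ℝ≥0∞).toReal) ?_ ?_ ?_ ?_
  · intro n
    have := (d n).continuous
    fun_prop
  · intro n
    refine ae_of_all _ fun s => ENNReal.rpow_le_rpow ?_ (by simp)
    exact enorm_le_iff_norm_le.mpr ((hdG n s).trans (le_abs_self _))
  · exact (lintegral_rpow_enorm_lt_top_of_eLpNorm_lt_top two_ne_zero ENNReal.ofNat_ne_top
      hG.eLpNorm_lt_top).ne
  · refine ae_of_all _ fun s => tendsto_const_nhds.congr' ?_
    obtain ⟨n₀, hn₀⟩ := exists_nat_gt |s|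
    filter_upwards [eventually_ge_atTop n₀] with n hn
    rw [hd0 n s (hn₀.trans_le (by exact_mod_cast hn))]
    simp

lemma exists_cutoff : ∃ (C : ℝ) (χ : ℕ → ℝ → ℂ), ∀ n : ℕ, ContDiff ℝ (⊤ : ℕ∞) (χ n) ∧
    HasCompactSupport (χ n) ∧ (∀ s : ℝ, |s| < n → χ n s = 1) ∧ (∀ s, ‖χ n s‖ ≤ C) ∧
    (∀ s, ‖deriv (χ n) s‖ ≤ C) ∧ ∀ s, ‖deriv (deriv (χ n)) s‖ ≤ C := by
  let b : ContDiffBump (0 : ℝ) := ⟨1, 2, one_pos, one_lt_two⟩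
  let χ : ℝ → ℂ := fun s => (b s : ℂ)
  have hχ : ContDiff ℝ (⊤ : ℕ∞) χ := Complex.ofRealCLM.contDiff.comp b.contDiff
  have hχc : HasCompactSupport χ := b.hasCompactSupport.comp_left Complex.ofReal_zero
  have hχ1 : ContDiff ℝ (⊤ : ℕ∞) (deriv χ) := (contDiff_infty_iff_deriv.mp hχ).2
  have hχ2 : ContDiff ℝ (⊤ : ℕ∞) (deriv (deriv χ)) := (contDiff_infty_iff_deriv.mp hχ1).2
  obtain ⟨C₀, h0⟩ := hχc.exists_bound_of_continuous hχ.continuous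
  obtain ⟨C₁, h1⟩ := hχc.deriv.exists_bound_of_continuous hχ1.continuous
  obtain ⟨C₂, h2⟩ := hχc.deriv.deriv.exists_bound_of_continuous hχ2.continuous
  have hd : ∀ (c : ℝ) (f : ℝ → ℂ), deriv (fun s => f (c * s)) = fun s => c • deriv f (c * s) :=
    fun c f => funext fun s => deriv_comp_mul_left c f s
  -- Dilating by $n+1\ge1$ puts factors at most 1 in front of the derivatives, so the bounds are
  -- uniform in $n$; the shift avoids dividing by zero at $n=0$.
  refine ⟨max C₀ (max C₁ C₂), fun n s => χ (((n : ℝ) + 1)⁻¹ * s), fun n => ?_⟩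
  have hn : (0 : ℝ) < (n : ℝ) + 1 := by positivity
  have hn1 : ‖((n : ℝ) + 1)⁻¹‖ ≤ 1 := by
    rw [norm_inv, Real.norm_of_nonneg hn.le]
    exact inv_le_one_of_one_le₀ (by linarith [(Nat.cast_nonneg n : (0 : ℝ) ≤ n)])
  refine ⟨hχ.comp (contDiff_const.mul contDiff_id), ?_, fun s hs => ?_, fun s => ?_, fun s => ?_,
    fun s => ?_⟩
  · exact hχc.comp_homeomorph (Homeomorph.mulLeft₀ _ (inv_ne_zero hn.ne'))
  · have hb : b (((n : ℝ) + 1)⁻¹ * s) = 1 := by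
      refine b.one_of_mem_closedBall ?_
      rw [mem_closedBall_zero_iff, norm_mul, norm_inv, Real.norm_of_nonneg hn.le,
        Real.norm_eq_abs, inv_mul_le_iff₀ hn]
      change |s| ≤ ((n : ℝ) + 1) * 1
      linarith
    change ((b _ : ℝ) : ℂ) = 1
    rw [hb, Complex.ofReal_one]
  · exact (h0 _).trans (le_max_left _ _)
  · rw [hd, norm_smul]
    exact (mul_le_of_le_one_left (norm_nonneg _) hn1).trans
      ((h1 _).trans ((le_max_left _ _).trans (le_max_right _ _)))
  · rw [hd, deriv_fun_const_smul_field, hd, norm_smul, norm_smul]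
    refine (mul_le_of_le_one_left (by positivity) hn1).trans ?_
    exact (mul_le_of_le_one_left (norm_nonneg _) hn1).trans
      ((h2 _).trans ((le_max_right _ _).trans (le_max_right _ _)))

/-- The constant coefficient operator `α ∂² + β ∂ + γ` on Schwartz functions. -/
def schwartzOp (α β γ : ℂ) : 𝓢(ℝ, ℂ) →L[ℂ] 𝓢(ℝ, ℂ) :=
  α • (SchwartzMap.derivCLM ℂ ℂ ∘L SchwartzMap.derivCLM ℂ ℂ) + β • SchwartzMap.derivCLM ℂ ℂ +
    γ • ContinuousLinearMap.id ℂ _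

lemma schwartzOp_apply (α β γ : ℂ) (g : 𝓢(ℝ, ℂ)) :
    schwartzOp α β γ g = α • SchwartzMap.derivCLM ℂ ℂ (SchwartzMap.derivCLM ℂ ℂ g) +
      β • SchwartzMap.derivCLM ℂ ℂ g + γ • g := rfl

/-- Take $h_n=\chi_n g$. By Leibniz, the errors in $h_n,h_n',h_n''$ are combinations of $g,g',g''$
with bounded coefficients vanishing for $|s|<n$. -/
lemma exists_tendsto_compactSupport (g : 𝓢(ℝ, ℂ)) : ∃ h : ℕ → 𝓢(ℝ, ℂ),
    (∀ n, HasCompactSupport (h n)) ∧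
    Tendsto (fun n => (h n).toLp 2 (volume : Measure ℝ)) atTop (nhds (g.toLp 2 volume)) ∧
    Tendsto (fun n => (SchwartzMap.derivCLM ℂ ℂ (h n)).toLp 2 (volume : Measure ℝ)) atTop
      (nhds ((SchwartzMap.derivCLM ℂ ℂ g).toLp 2 volume)) ∧
    Tendsto (fun n => (SchwartzMap.derivCLM ℂ ℂ (SchwartzMap.derivCLM ℂ ℂ (h n))).toLp 2
      (volume : Measure ℝ)) atTop
      (nhds ((SchwartzMap.derivCLM ℂ ℂ (SchwartzMap.derivCLM ℂ ℂ g)).toLp 2 volume)) := by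
  obtain ⟨C, χ, hχ⟩ := exists_cutoff
  choose hs hc h1 hC0 hC1 hC2 using hχ
  have hC : 0 ≤ C := (norm_nonneg _).trans (hC0 0 0)
  have hcg : ∀ n, HasCompactSupport fun s => χ n s * g s := fun n => (hc n).mul_right
  let h : ℕ → 𝓢(ℝ, ℂ) := fun n => (hcg n).toSchwartzMap ((hs n).mul (g.smooth ⊤))
  set g₁ := SchwartzMap.derivCLM ℂ ℂ g with hg₁
  set g₂ := SchwartzMap.derivCLM ℂ ℂ g₁ with hg₂
  have hz1 : ∀ (n : ℕ) (s : ℝ), |s| < n → deriv (χ n) s = 0 := fun n s hsn => by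
    have : χ n =ᶠ[nhds s] fun _ => 1 := by
      filter_upwards [(isOpen_lt continuous_abs continuous_const).mem_nhds hsn] with t ht
      exact h1 n t ht
    rw [this.deriv_eq, deriv_const]
  have hz2 : ∀ (n : ℕ) (s : ℝ), |s| < n → deriv (deriv (χ n)) s = 0 := fun n s hsn => by
    have : deriv (χ n) =ᶠ[nhds s] fun _ => 0 := by
      filter_upwards [(isOpen_lt continuous_abs continuous_const).mem_nhds hsn] with t ht
      exact hz1 n t ht
    rw [this.deriv_eq, deriv_const]
  have hdχ : ∀ n s, HasDerivAt (χ n) (deriv (χ n) s) s := fun n s =>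
    ((hs n).differentiable (by simp) s).hasDerivAt
  have hdχ' : ∀ n s, HasDerivAt (deriv (χ n)) (deriv (deriv (χ n)) s) s := fun n s =>
    ((contDiff_infty_iff_deriv.mp (hs n)).2.differentiable (by simp) s).hasDerivAt
  have hD1 : ∀ n s, SchwartzMap.derivCLM ℂ ℂ (h n) s = deriv (χ n) s * g s + χ n s * g₁ s :=
    fun n s => ((hdχ n s).mul (g.hasDerivAt s)).deriv
  have hD2 : ∀ n s, SchwartzMap.derivCLM ℂ ℂ (SchwartzMap.derivCLM ℂ ℂ (h n)) s =
      deriv (deriv (χ n)) s * g s + deriv (χ n) s * g₁ s +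
        (deriv (χ n) s * g₁ s + χ n s * g₂ s) := fun n s => by
    rw [SchwartzMap.derivCLM_apply, funext (hD1 n)]
    exact (((hdχ' n s).mul (g.hasDerivAt s)).add ((hdχ n s).mul (g₁.hasDerivAt s))).deriv
  -- One estimate serves all three limits: $2C+1$ dominates $|\chi_n-1|$, $|2\chi_n'|$ and
  -- $|\chi_n''|$.
  have key : ∀ (e : ℕ → 𝓢(ℝ, ℂ)) (f : 𝓢(ℝ, ℂ)) (a b c : ℕ → ℝ → ℂ),
      (∀ n s, e n s - f s = a n s * g s + b n s * g₁ s + c n s * g₂ s) →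
      (∀ n s, ‖a n s‖ ≤ 2 * C + 1) → (∀ n s, ‖b n s‖ ≤ 2 * C + 1) →
      (∀ n s, ‖c n s‖ ≤ 2 * C + 1) →
      (∀ (n : ℕ) (s : ℝ), |s| < n → a n s = 0 ∧ b n s = 0 ∧ c n s = 0) →
      Tendsto (fun n => (e n).toLp 2 (volume : Measure ℝ)) atTop (nhds (f.toLp 2 volume)) := by
    intro e f a b c he ha hb hc h0
    rw [← tendsto_sub_nhds_zero_iff]
    have hsub : ∀ n, (e n).toLp 2 (volume : Measure ℝ) - f.toLp 2 volume =
        (e n - f).toLp 2 volume := fun n =>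
      (map_sub (SchwartzMap.toLpCLM ℂ ℂ 2 (volume : Measure ℝ)) (e n) f).symm
    simp_rw [hsub]
    refine tendsto_toLp_zero (G := fun s => (2 * C + 1) * (‖g s‖ + ‖g₁ s‖ + ‖g₂ s‖))
      ((((g.memLp 2).norm.add (g₁.memLp 2).norm).add (g₂.memLp 2).norm).const_mul _) ?_ ?_
    · intro n s
      change ‖e n s - f s‖ ≤ _
      rw [he, mul_add, mul_add]
      refine norm_add₃_le.trans ?_
      rw [norm_mul, norm_mul, norm_mul]
      gcongr
      exacts [ha n s, hb n s, hc n s]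
    · intro n s hsn
      obtain ⟨h1, h2, h3⟩ := h0 n s hsn
      change e n s - f s = 0
      rw [he, h1, h2, h3]
      simp
  have hsub1 : ∀ n s, ‖χ n s - 1‖ ≤ 2 * C + 1 := fun n s => by
    refine (norm_sub_le _ _).trans ?_
    rw [norm_one]
    linarith [hC0 n s]
  refine ⟨h, hcg, ?_, ?_, ?_⟩
  · refine key h g (fun n s => χ n s - 1) (fun _ _ => 0) (fun _ _ => 0) (fun n s => ?_) hsub1
      (fun _ _ => by rw [norm_zero]; positivity) (fun _ _ => by rw [norm_zero]; positivity)
      fun n s hsn => ⟨by rw [h1 n s hsn, sub_self], rfl, rfl⟩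
    change χ n s * g s - g s = _
    ring
  · refine key _ g₁ (fun n s => deriv (χ n) s) (fun n s => χ n s - 1) (fun _ _ => 0)
      (fun n s => ?_) (fun n s => by linarith [hC1 n s]) hsub1
      (fun _ _ => by rw [norm_zero]; positivity)
      fun n s hsn => ⟨hz1 n s hsn, by rw [h1 n s hsn, sub_self], rfl⟩
    rw [hD1]
    ring
  · refine key _ g₂ (fun n s => deriv (deriv (χ n)) s) (fun n s => 2 * deriv (χ n) s)
      (fun n s => χ n s - 1) (fun n s => ?_) (fun n s => by linarith [hC2 n s])
      (fun n s => ?_) hsub1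
      fun n s hsn => ⟨hz2 n s hsn, by rw [hz1 n s hsn, mul_zero], by rw [h1 n s hsn, sub_self]⟩
    · rw [hD2]
      ring
    · rw [norm_mul, RCLike.norm_ofNat]
      linarith [hC1 n s]

lemma mem_closure_schwartzOp (α β γ : ℂ) (g : 𝓢(ℝ, ℂ)) :
    (g.toLp 2 volume, (schwartzOp α β γ g).toLp 2 volume) ∈
      closure {p : Lp ℂ 2 (volume : Measure ℝ) × Lp ℂ 2 (volume : Measure ℝ) |
        ∃ h : 𝓢(ℝ, ℂ), HasCompactSupport h ∧
          p = (h.toLp 2 volume, (schwartzOp α β γ h).toLp 2 volume)} := by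
  obtain ⟨h, hc, h0, h1, h2⟩ := exists_tendsto_compactSupport g
  have hop : ∀ k : 𝓢(ℝ, ℂ), (schwartzOp α β γ k).toLp 2 (volume : Measure ℝ) =
      α • (SchwartzMap.derivCLM ℂ ℂ (SchwartzMap.derivCLM ℂ ℂ k)).toLp 2 volume +
        β • (SchwartzMap.derivCLM ℂ ℂ k).toLp 2 volume + γ • k.toLp 2 volume := fun k => by
    rw [schwartzOp_apply]
    simp only [← SchwartzMap.toLpCLM_apply (𝕜 := ℂ), map_add, map_smul]
  refine mem_closure_of_tendsto
    (f := fun n => ((h n).toLp 2 volume, (schwartzOp α β γ (h n)).toLp 2 volume))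
    (b := atTop) ?_ (Eventually.of_forall fun n => ⟨h n, hc n, rfl⟩)
  simp_rw [hop]
  exact h0.prodMk_nhds (((h2.const_smul α).add (h1.const_smul β)).add (h0.const_smul γ))

/-! ### The Fourier transform of Schwartz functions -/

lemma fourierL2_schwartz_eq (g : 𝓢(ℝ, ℂ)) :
    fourierL2 (g.toLp 2 volume) =ᵐ[volume] fun σ =>
      (((Real.sqrt (2 * Real.pi))⁻¹ : ℝ) : ℂ) * 𝓕 g ((2 * Real.pi)⁻¹ * σ) := by
  have h1 : fourierL2 (g.toLp 2 volume) = dilation ((𝓕 g).toLp 2 volume) :=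
    congrArg dilation (SchwartzMap.toLp_fourier_eq g)
  rw [h1]
  have h2 := weightedCompEquiv_coeFn (w := fun _ => (Real.sqrt (2 * Real.pi))⁻¹)
    (φ := fun σ => (2 * Real.pi)⁻¹ * σ)
    (v := fun _ => Real.sqrt (2 * Real.pi)) (ψ := fun ξ => (2 * Real.pi) * ξ)
    (by fun_prop) (by fun_prop) (by fun_prop) measurePreserving_dilation
    (fun σ => mul_inv_cancel_left₀ (by positivity) σ)
    (fun _ => inv_mul_cancel₀ (by positivity)) ((𝓕 g).toLp 2 volume)
  have h3 := ae_of_ae_map (by fun_prop) (ae_of_all _ fun _ => by positivity)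
    measurePreserving_dilation ((𝓕 g).coeFn_toLp 2 volume)
  filter_upwards [h2, h3] with σ h2 h3
  refine h2.trans ?_
  rw [h3]

lemma fourier_derivCLM (g : 𝓢(ℝ, ℂ)) (ξ : ℝ) :
    𝓕 (SchwartzMap.derivCLM ℂ ℂ g) ξ = 2 * Real.pi * Complex.I * ξ * 𝓕 g ξ := by
  have h := congrFun (Real.fourier_deriv g.integrable g.differentiable
    (SchwartzMap.derivCLM ℂ ℂ g).integrable) ξ
  have h' : 𝓕 (deriv g) ξ = 2 * Real.pi * Complex.I * ξ * 𝓕 (g : ℝ → ℂ) ξ := by simpa using h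
  exact h'

/-- Each derivative contributes $2\pi i\xi$, and the dilation $\xi=\sigma/2\pi$ makes this
$i\sigma$. -/
lemma fourierL2_schwartzOp (α β γ : ℂ) (g : 𝓢(ℝ, ℂ)) :
    fourierL2 ((schwartzOp α β γ g).toLp 2 volume) =ᵐ[volume] fun σ =>
      (α * (Complex.I * σ) ^ 2 + β * (Complex.I * σ) + γ) * fourierL2 (g.toLp 2 volume) σ := by
  filter_upwards [fourierL2_schwartz_eq g, fourierL2_schwartz_eq (schwartzOp α β γ g)] with σ h1 h2
  have hF : 𝓕 (schwartzOp α β γ g) =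
      α • 𝓕 (SchwartzMap.derivCLM ℂ ℂ (SchwartzMap.derivCLM ℂ ℂ g)) +
        β • 𝓕 (SchwartzMap.derivCLM ℂ ℂ g) + γ • 𝓕 g := by
    rw [schwartzOp_apply]
    simp only [FourierTransform.fourier_add, FourierTransform.fourier_smul]
  have hpi : (Real.pi : ℂ) ≠ 0 := by exact_mod_cast Real.pi_ne_zero
  rw [h1, h2, hF]
  change _ * (α * 𝓕 (SchwartzMap.derivCLM ℂ ℂ (SchwartzMap.derivCLM ℂ ℂ g)) _ +
        β * 𝓕 (SchwartzMap.derivCLM ℂ ℂ g) _ + γ * 𝓕 g _) = _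
  rw [fourier_derivCLM, fourier_derivCLM]
  push_cast
  field_simp

lemma exists_fourierL2_eq (k : 𝓢(ℝ, ℂ)) :
    ∃ g : 𝓢(ℝ, ℂ), fourierL2 (g.toLp 2 volume) = k.toLp 2 volume := by
  have hpi : (2 * Real.pi) ≠ 0 := by positivity
  let e : ℝ ≃L[ℝ] ℝ := ContinuousLinearEquiv.unitsEquivAut ℝ (Units.mk0 (2 * Real.pi) hpi)
  refine ⟨𝓕⁻ (((Real.sqrt (2 * Real.pi) : ℝ) : ℂ) •
    SchwartzMap.compCLMOfContinuousLinearEquiv ℂ e k), Lp.ext ?_⟩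
  refine (fourierL2_schwartz_eq _).trans ?_
  filter_upwards [k.coeFn_toLp 2 volume] with σ h
  have hs : (Real.sqrt (2 * Real.pi) : ℂ) ≠ 0 := by
    exact_mod_cast (Real.sqrt_pos.mpr (by positivity)).ne'
  have he : e ((2 * Real.pi)⁻¹ * σ) = σ := by
    change (2 * Real.pi)⁻¹ * σ * (2 * Real.pi) = σ
    field_simp
  rw [FourierTransform.fourier_fourierInv_eq, h, _root_.smul_apply,
    SchwartzMap.compCLMOfContinuousLinearEquiv_apply, Function.comp_apply, he, smul_eq_mul,
    Complex.ofReal_inv, inv_mul_cancel_left₀ hs]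

/-! ### Test functions in logarithmic coordinates -/

/-- The Schwartz function `s ↦ e^((N-2)s/2) f(e^s)` for `f ∈ C_c^∞(ℝ₊)`. -/
def logPull (N : ℕ) : 𝓓(posReals, ℂ) →ₗ[ℂ] 𝓢(ℝ, ℂ) where
  toFun f := HasCompactSupport.toSchwartzMap
    (f := fun s : ℝ => (Real.exp (((N : ℝ) - 2) / 2 * s) : ℂ) * f (Real.exp s))
    (by
      have hK : IsCompact (Real.log '' tsupport f) :=
        f.hasCompactSupport.isCompact.image_of_continuousOn
          (Real.continuousOn_log.mono fun r hr => (f.tsupport_subset hr : (0 : ℝ) < r).ne')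
      refine HasCompactSupport.intro hK fun s hs => ?_
      rw [image_eq_zero_of_notMem_tsupport fun h => hs ⟨_, h, Real.log_exp s⟩, mul_zero])
    (by
      have h1 : ContDiff ℝ (⊤ : ℕ∞) fun s : ℝ => Real.exp (((N : ℝ) - 2) / 2 * s) :=
        Real.contDiff_exp.comp (contDiff_const.mul contDiff_id)
      exact (Complex.ofRealCLM.contDiff.comp h1).mul (f.contDiff.comp Real.contDiff_exp))
  map_add' f g := by
    ext s
    exact mul_add _ _ _
  map_smul' c f := by
    ext s
    exact mul_left_comm _ _ _

lemma logPull_apply (N : ℕ) (f : 𝓓(posReals, ℂ)) (s : ℝ) :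
    logPull N f s = (Real.exp (((N : ℝ) - 2) / 2 * s) : ℂ) * f (Real.exp s) := rfl

lemma radialU_testToL2 (N : ℕ) (f : 𝓓(posReals, ℂ)) :
    radialU N (testToL2 N f) = (logPull N f).toLp 2 volume := by
  refine Lp.ext ?_
  filter_upwards [radialU_coeFn N (testToL2 N f), (logPull N f).coeFn_toLp 2 volume,
    ae_of_ae_map (by fun_prop) (ae_of_all _ fun s => (Real.exp_pos _).ne') (measurePreserving_exp N)
      (memLp_testFunction N f).coeFn_toLp] with s h1 h2 h3
  rw [h1, h2, logPull_apply]
  congr 1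

/-- The conjugate `ϑ + (N - 2)/2` of `d/ds` under `U_N`. -/
def eulerShift (N : ℕ) : Module.End ℂ 𝓓(posReals, ℂ) :=
  euler + (((N : ℂ) - 2) / 2) • 1

lemma logPull_eulerShift (N : ℕ) (f : 𝓓(posReals, ℂ)) :
    logPull N (eulerShift N f) = SchwartzMap.derivCLM ℂ ℂ (logPull N f) := by
  ext s
  have h1 : HasDerivAt (fun s : ℝ => (Real.exp (((N : ℝ) - 2) / 2 * s) : ℂ))
      ((Real.exp (((N : ℝ) - 2) / 2 * s) * (((N : ℝ) - 2) / 2) : ℝ) : ℂ) s := by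
    refine HasDerivAt.ofReal_comp ?_
    simpa using ((hasDerivAt_id s).const_mul (((N : ℝ) - 2) / 2)).exp
  have h2 : HasDerivAt (fun s : ℝ => f (Real.exp s)) (Real.exp s • deriv f (Real.exp s)) s :=
    HasDerivAt.scomp s (f.contDiff.differentiable (by simp) _).hasDerivAt (Real.hasDerivAt_exp s)
  rw [SchwartzMap.derivCLM_apply]
  refine Eq.trans ?_ (h1.mul h2).deriv.symm
  change ((Real.exp (((N : ℝ) - 2) / 2 * s) : ℝ) : ℂ) *
    ((Real.exp s : ℂ) * deriv f (Real.exp s) + (((N : ℂ) - 2) / 2) * f (Real.exp s)) = _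
  rw [Complex.real_smul]
  push_cast
  ring

/-- The preimage is $r^{-k}g(\log r)$ with $k=(N-2)/2$, extended by zero. -/
lemma exists_logPull_eq (N : ℕ) {g : 𝓢(ℝ, ℂ)} (hg : HasCompactSupport g) :
    ∃ f, logPull N f = g := by
  have hK : IsCompact (Real.exp '' tsupport g) := hg.isCompact.image Real.continuous_exp
  -- The indicator is essential: `Real.log` is even, so the bare formula would also be supported on
  -- the negative axis.
  let F : ℝ → ℂ := (Ioi 0).indicator fun r =>
    (Real.exp (-(((N : ℝ) - 2) / 2 * Real.log r)) : ℂ) * g (Real.log r)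
  have hF0 : ∀ r ∉ Real.exp '' tsupport g, F r = 0 := fun r hr => by
    refine indicator_apply_eq_zero.mpr fun hr0 => ?_
    rw [image_eq_zero_of_notMem_tsupport fun h => hr ⟨_, h, Real.exp_log hr0⟩, mul_zero]
  have hsupp : tsupport F ⊆ Real.exp '' tsupport g :=
    closure_minimal (fun r hr => by_contra fun h => hr (hF0 r h)) hK.isClosed
  have hpos : Real.exp '' tsupport g ⊆ Ioi 0 := by
    rintro _ ⟨s, -, rfl⟩
    exact Real.exp_pos s
  have hsmooth : ContDiff ℝ (⊤ : ℕ∞) F := by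
    rw [contDiff_iff_contDiffAt]
    intro r
    -- On this compact subset of $(0,\infty)$ the formula holds nearby; off it, $F$ vanishes on an
    -- open neighbourhood.
    by_cases hr : r ∈ Real.exp '' tsupport g
    · have hr0 : r ∈ Ioi (0 : ℝ) := hpos hr
      have hlog : ContDiffAt ℝ (⊤ : ℕ∞) Real.log r := Real.contDiffAt_log.mpr (ne_of_gt hr0)
      have h1 : ContDiffAt ℝ (⊤ : ℕ∞) (fun r =>
          (Real.exp (-(((N : ℝ) - 2) / 2 * Real.log r)) : ℂ) * g (Real.log r)) r :=
        (Complex.ofRealCLM.contDiff.contDiffAt.comp r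
          (contDiffAt_const.mul hlog).neg.exp).mul ((g.smooth ⊤).contDiffAt.comp r hlog)
      refine h1.congr_of_eventuallyEq ?_
      filter_upwards [isOpen_Ioi.mem_nhds hr0] with t ht
      exact indicator_of_mem ht _
    · refine (contDiffAt_const (c := (0 : ℂ))).congr_of_eventuallyEq ?_
      filter_upwards [hK.isClosed.isOpen_compl.mem_nhds hr] with t ht
      exact hF0 t ht
  refine ⟨⟨F, hsmooth, hK.of_isClosed_subset (isClosed_tsupport _) hsupp, hsupp.trans hpos⟩, ?_⟩
  ext s
  rw [logPull_apply]
  change (Real.exp (((N : ℝ) - 2) / 2 * s) : ℂ) * F (Real.exp s) = _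
  have h1 : F (Real.exp s) = (Real.exp (-(((N : ℝ) - 2) / 2 * s)) : ℂ) * g s := by
    refine (indicator_of_mem (Real.exp_pos s) _).trans ?_
    rw [Real.log_exp]
  rw [h1, ← mul_assoc, ← Complex.ofReal_mul, ← Real.exp_add, add_neg_cancel, Real.exp_zero,
    Complex.ofReal_one, one_mul]

/-! ### The closure of a quadratic polynomial in `ϑ + (N - 2)/2` -/

/-- The operator `α E² + β E + γ` on `C_c^∞(ℝ₊)`, where `E = ϑ + (N - 2)/2`. -/
def eulerPoly (N : ℕ) (α β γ : ℂ) : Module.End ℂ 𝓓(posReals, ℂ) :=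
  α • (eulerShift N * eulerShift N) + β • eulerShift N + γ • 1

lemma logPull_eulerPoly (N : ℕ) (α β γ : ℂ) (f : 𝓓(posReals, ℂ)) :
    logPull N (eulerPoly N α β γ f) = schwartzOp α β γ (logPull N f) := by
  rw [schwartzOp_apply, ← logPull_eulerShift, ← logPull_eulerShift]
  change logPull N (α • eulerShift N (eulerShift N f) + β • eulerShift N f + γ • f) = _
  simp only [map_add (logPull N), map_smul (logPull N)]

/-- The symbol `α (iσ)² + β (iσ) + γ`. -/
def symbol (α β γ : ℂ) (σ : ℝ) : ℂ := α * (Complex.I * σ) ^ 2 + β * (Complex.I * σ) + γ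

lemma contDiff_symbol (α β γ : ℂ) : ContDiff ℝ (⊤ : ℕ∞) (symbol α β γ) := by
  have h : ContDiff ℝ (⊤ : ℕ∞) fun σ : ℝ => Complex.I * (σ : ℂ) :=
    contDiff_const.mul Complex.ofRealCLM.contDiff
  exact ((contDiff_const.mul (h.pow 2)).add (contDiff_const.mul h)).add contDiff_const

lemma mem_graph_radialOp {N : ℕ} {D : Module.End ℂ 𝓓(posReals, ℂ)}
    {p : Lp ℂ 2 (radialMeasure N) × Lp ℂ 2 (radialMeasure N)} :
    p ∈ (radialOp N D).graph ↔ ∃ f, p = (testToL2 N f, testToL2 N (D f)) := by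
  rw [LinearPMap.mem_graph_iff']
  constructor
  · rintro ⟨⟨_, f, rfl⟩, rfl⟩
    exact ⟨f, Prod.ext rfl (radialOp_testToL2 N D f)⟩
  · rintro ⟨f, rfl⟩
    exact ⟨⟨_, f, rfl⟩, Prod.ext rfl (radialOp_testToL2 N D f)⟩

lemma radialU_trans_testToL2 (N : ℕ) (f : 𝓓(posReals, ℂ)) :
    ((radialU N).trans fourierL2) (testToL2 N f) =
      fourierL2 ((logPull N f).toLp 2 volume) := by
  rw [LinearIsometryEquiv.trans_apply, radialU_testToL2]

/-- Compactly supported Schwartz functions are exactly images of test functions, and they are dense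
in the graph norm of `schwartzOp`. -/
lemma schwartz_mem_topologicalClosure (N : ℕ) (α β γ : ℂ) (g : 𝓢(ℝ, ℂ)) :
    (fourierL2 (g.toLp 2 volume), fourierL2 ((schwartzOp α β γ g).toLp 2 volume)) ∈
      (unitaryConj ((radialU N).trans fourierL2)
        (radialOp N (eulerPoly N α β γ))).graph.topologicalClosure := by
  have hs : ∀ q ∈ {p : Lp ℂ 2 (volume : Measure ℝ) × Lp ℂ 2 (volume : Measure ℝ) |
      ∃ h : 𝓢(ℝ, ℂ), HasCompactSupport h ∧
        p = (h.toLp 2 volume, (schwartzOp α β γ h).toLp 2 volume)},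
      (fourierL2 q.1, fourierL2 q.2) ∈ (unitaryConj ((radialU N).trans fourierL2)
        (radialOp N (eulerPoly N α β γ))).graph := by
    rintro _ ⟨h, hc, rfl⟩
    obtain ⟨f, rfl⟩ := exists_logPull_eq N hc
    rw [mem_graph_unitaryConj, mem_graph_radialOp]
    refine ⟨f, ?_⟩
    rw [← logPull_eulerPoly, ← radialU_trans_testToL2, ← radialU_trans_testToL2,
      LinearIsometryEquiv.symm_apply_apply, LinearIsometryEquiv.symm_apply_apply]
  have h := prod_map_mem_closure fourierL2 (mem_closure_schwartzOp α β γ g) hs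
  exact h

lemma radialOp_eulerPoly_closure (N : ℕ) {α β γ : ℂ} (him : ∀ σ, (symbol α β γ σ).re = 0) :
    (radialOp N (eulerPoly N α β γ)).IsClosable ∧
      unitaryConj ((radialU N).trans fourierL2) (radialOp N (eulerPoly N α β γ)).closure =
        mulOp (symbol α β γ) := by
  have hM := isMaximalSkew_mulOp (contDiff_symbol α β γ).continuous.measurable him
  have hS : ∀ g : 𝓢(ℝ, ℂ), (fourierL2 (g.toLp 2 volume),
      fourierL2 ((schwartzOp α β γ g).toLp 2 volume)) ∈ (mulOp (symbol α β γ)).graph := fun g =>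
    mem_graph_mulOp.mpr (fourierL2_schwartzOp α β γ g)
  refine unitaryConj_closure_eq _ _ hM.isClosed (fun p hp => ?_) ?_
  · obtain ⟨f, hf⟩ := mem_graph_radialOp.mp ((mem_graph_unitaryConj _ _ _).mp hp)
    have h1 := congrArg (fun q => ((radialU N).trans fourierL2 q.1,
      (radialU N).trans fourierL2 q.2)) hf
    simp only [LinearIsometryEquiv.apply_symm_apply, radialU_trans_testToL2,
       logPull_eulerPoly] at h1
    change (p.1, p.2) ∈ _
    rw [h1]
    exact hS _
  · have hsub := (graph_mulOp_subset_closure (contDiff_symbol α β γ) him).trans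
      (closure_minimal (t := ((unitaryConj ((radialU N).trans fourierL2)
        (radialOp N (eulerPoly N α β γ))).graph.topologicalClosure : Set _)) ?_
        (Submodule.isClosed_topologicalClosure _))
    · exact hsub
    · rintro ⟨x, y⟩ ⟨hp, k, hk⟩
      obtain ⟨g, hg⟩ := exists_fourierL2_eq k
      obtain rfl : x = fourierL2 (g.toLp 2 volume) := hk.trans hg.symm
      -- A graph is single-valued, so $y$ must be the transform of `schwartzOp α β γ g`.
      rw [LinearPMap.mem_graph_snd_inj _ hp (hS g) rfl]
      exact schwartz_mem_topologicalClosure N α β γ g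

lemma isEssSkewAdjointOp_eulerPoly (N : ℕ) {α β γ : ℂ} (him : ∀ σ, (symbol α β γ σ).re = 0) :
    IsEssSkewAdjointOp (radialOp N (eulerPoly N α β γ)) := by
  obtain ⟨hc, heq⟩ := radialOp_eulerPoly_closure N him
  have hM := isMaximalSkew_mulOp (contDiff_symbol α β γ).continuous.measurable him
  rw [← heq] at hM
  have hT := hM.of_unitaryConj
  refine ⟨?_, hc, hT.isSkewAdjointOp⟩
  -- The domain of the closure is dense, and it lies in the closure of the original domain by
  -- projecting the closed graph to its first factor.
  refine dense_iff_closure_eq.mpr (eq_univ_of_univ_subset ?_)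
  rw [← hT.dense_domain.closure_eq]
  refine closure_minimal (fun x hx => ?_) isClosed_closure
  obtain ⟨y, hy⟩ := LinearPMap.mem_domain_iff.mp hx
  rw [← hc.graph_closure_eq_closure_graph, ← SetLike.mem_coe,
    Submodule.topologicalClosure_coe] at hy
  exact map_mem_closure continuous_fst hy fun p hp => LinearPMap.mem_domain_of_mem_graph hp

/-! ### The generators as quadratic polynomials in $\vartheta+(N-2)/2$ -/

lemma opH_eq (N : ℕ) : opH N = eulerPoly N 0 2 0 := by
  simp only [opH, eulerPoly, eulerShift]
  module

lemma opI_eq (N : ℕ) : opI = eulerPoly N 0 0 Complex.I := by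
  simp only [opI, eulerPoly]
  module

/-- A difference of squares: with $k=(N-2)/2$, the factors are $E-(m+k)$ and $E+(m+k)$. -/
lemma opE_eq (N m : ℕ) : opE N m =
    eulerPoly N Complex.I 0 (-Complex.I * ((m : ℂ) + ((N : ℂ) - 2) / 2) ^ 2) := by
  simp only [opE, eulerPoly, eulerShift, mul_add, add_mul, sub_mul, mul_smul_comm, smul_mul_assoc,
    mul_one, one_mul]
  module

lemma exists_eq_eulerPoly (N m : ℕ) {D : Module.End ℂ 𝓓(posReals, ℂ)} (hD : D ∈ gRad N m) :
    ∃ a b c : ℝ, D = eulerPoly N (c * Complex.I) a (b * Complex.I) := by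
  rw [gRad, Submodule.mem_span_triple] at hD
  obtain ⟨a, b, c, rfl⟩ := hD
  refine ⟨2 * a, b - c * ((m : ℝ) + ((N : ℝ) - 2) / 2) ^ 2, c, ?_⟩
  rw [opH_eq, opI_eq N, opE_eq]
  simp only [← Complex.coe_smul (E := Module.End ℂ 𝓓(posReals, ℂ)), eulerPoly]
  push_cast
  module

end RadialSpectral

end

theorem mainTheorem5 (N m : ℕ) (hN : 1 ≤ N) :
    (∀ D ∈ RadialSpectral.gRad N m,
      RadialSpectral.IsEssSkewAdjointOp (RadialSpectral.radialOp N D)) ∧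
    RadialSpectral.unitaryConj ((RadialSpectral.radialU N).trans RadialSpectral.fourierL2)
        (RadialSpectral.radialOp N (RadialSpectral.opH N)).closure =
      RadialSpectral.mulOp (fun σ : ℝ => 2 * Complex.I * (σ : ℂ)) ∧
    RadialSpectral.unitaryConj ((RadialSpectral.radialU N).trans RadialSpectral.fourierL2)
        (RadialSpectral.radialOp N RadialSpectral.opI).closure =
      RadialSpectral.mulOp (fun _ : ℝ => Complex.I) ∧
    RadialSpectral.unitaryConj ((RadialSpectral.radialU N).trans RadialSpectral.fourierL2)
        (RadialSpectral.radialOp N (RadialSpectral.opE N m)).closure =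
      RadialSpectral.mulOp (fun σ : ℝ =>
        -Complex.I * ((σ : ℂ) ^ 2 + ((m : ℂ) + ((N : ℂ) - 2) / 2) ^ 2)) := by
  -- Since $(i\sigma)^2=-\sigma^2$ is real, each of $ci(i\sigma)^2$, $a\,i\sigma$ and $bi$ is
  -- imaginary.
  have hsymbol : ∀ (a b c : ℝ) (σ : ℝ),
      (RadialSpectral.symbol (c * Complex.I) a (b * Complex.I) σ).re = 0 := fun a b c σ => by
    simp [RadialSpectral.symbol, mul_pow, ← Complex.ofReal_pow]
  refine ⟨fun D hD => ?_, ?_, ?_, ?_⟩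
  · obtain ⟨a, b, c, rfl⟩ := RadialSpectral.exists_eq_eulerPoly N m hD
    exact RadialSpectral.isEssSkewAdjointOp_eulerPoly N (hsymbol a b c)
  · have h : (fun σ : ℝ => 2 * Complex.I * (σ : ℂ)) = RadialSpectral.symbol 0 2 0 := by
      funext σ
      simp only [RadialSpectral.symbol]
      ring
    rw [h, RadialSpectral.opH_eq]
    refine (RadialSpectral.radialOp_eulerPoly_closure N fun σ => ?_).2
    simpa using hsymbol 2 0 0 σ
  · have h : (fun _ : ℝ => Complex.I) = RadialSpectral.symbol 0 0 Complex.I := by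
      funext σ
      simp only [RadialSpectral.symbol]
      ring
    rw [h, RadialSpectral.opI_eq N]
    refine (RadialSpectral.radialOp_eulerPoly_closure N fun σ => ?_).2
    simpa using hsymbol 0 1 0 σ
  · have h : (fun σ : ℝ => -Complex.I * ((σ : ℂ) ^ 2 + ((m : ℂ) + ((N : ℂ) - 2) / 2) ^ 2)) =
        RadialSpectral.symbol Complex.I 0
          (-Complex.I * ((m : ℂ) + ((N : ℂ) - 2) / 2) ^ 2) := by
      funext σ
      simp only [RadialSpectral.symbol, mul_pow, Complex.I_sq]
      ring
    rw [h, RadialSpectral.opE_eq]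
    refine (RadialSpectral.radialOp_eulerPoly_closure N fun σ => ?_).2
    have h1 := hsymbol 0 (-((m : ℝ) + ((N : ℝ) - 2) / 2) ^ 2) 1 σ
    convert h1 using 3
    · simp
    · simp
    · push_cast
      ring
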